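/- Call a function $d : S \times S \to [0,\infty]$ on a set $S$ a \emph{metric} (in the sense of Lawvere) if $d(s,s)=0$ and $d(s,s'') \le d(s,s') + d(s',s'')$ for all $s,s',s'' \in S$; a metric is \emph{classical} if moreover it takes only finite values, $d(s,s')=0$ implies $s=s'$, and $d(s,s')=d(s',s)$ for all $s,s'$. A \emph{metric measure space} is a Polish space $X$ with its Borel $\sigma$-algebra, together with a metric $d_X : X\times X\to[0,\infty]$ that is lower semicontinuous for the topology of $X$ (but need not metrize it) and a $\sigma$-finite measure $\mu_X$. Let $X$ and $Y$ be metric measure spaces and let $1 \le p < \infty$. For Markov kernels $M, N : X \to Y$, let $\mathrm{Coup}(M,N)$ be the set of Markov kernels $\Pi : X \to Y \times Y$ such that, for every $x \in X$, the measure $\Pi(\cdot \mid x)$ has first marginal $M(x)$ and second marginal $N(x)$, and put $$W_p(M,N) := \inf_{\Pi \in \mathrm{Coup}(M,N)} \left( \int_X \int_{Y \times Y} d_Y(y,y')^p \, \Pi(dy,dy' \mid x)\, \mu_X(dx) \right)^{1/p}.$$ Then $W_p$ is a metric on the set of Markov kernels $X \to Y$: $W_p(M,M)=0$ and $W_p(M_1,M_3)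 \le W_p(M_1,M_2) + W_p(M_2,M_3)$ for all Markov kernels $M, M_1, M_2, M_3 : X \to Y$. Moreover, suppose that $d_Y$ is a classical metric. For $y_0 \in Y$, say that a Markov kernel $M : X \to Y$ has finite moment of order $p$ with respect to $y_0$ if $$\int_X \int_Y d_Y(y_0,y)^p \, M(dy \mid x)\, \mu_X(dx) < \infty,$$ and regard Markov kernels $M, M'$ as equivalent if $M(x)=M'(x)$ for $\mu_X$-almost every $x \in X$. Then: 1. $W_p(M,N) = W_p(N,M)$ for all Markov kernels $M,N : X \to Y$, and $W_p(M,N)=0$ if and only if $M$ and $N$ are equivalent. 2. For every $y_0 \in Y$, $W_p$ is well defined on equivalence classes of Markov kernels $X \to Y$ with finite moment of order $p$ with respect to $y_0$, and it is a classical metric on the set of these classes. 3. If the measure $\mu_X$ is finite, then a Markov kernel that has finite moment of order $p$ with respect to some $y_0 \in Y$ has finite moment of order $p$ with respect to every point of $Y$, and $W_p$ is well defined and a classical metric on equivalence classes of Markov kernels with finite moment of order $p$ (with respect to some, hence any, point). -/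

import Mathlib

open MeasureTheory ProbabilityTheory
open scoped ENNReal

universe u v

/-- A metric in the sense of Lawvere: an extended nonnegative distance satisfying the identity law
and the triangle inequality. -/
structure IsLawvereMetric {S : Type u} (d : S → S → ℝ≥0∞) : Prop where
  self : ∀ x, d x x = 0
  triangle : ∀ x y z, d x z ≤ d x y + d y z

/-- A classical metric: a Lawvere metric that is finite, positive definite and symmetric. -/
structure IsClassicalMetric {S : Type u} (d : S → S → ℝ≥0∞) : Prop extends IsLawvereMetric d where
  finite : ∀ x y, d x y < ∞
  posDef : ∀ x y, d x y = 0 → x = y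
  symm : ∀ x y, d x y = d y x

/-- The structure of a metric measure space on a Polish space `X` with its Borel σ-algebra: a
lower semicontinuous Lawvere metric, which need not metrize the topology, and a σ-finite measure. -/
structure MMStructure (X : Type u) [TopologicalSpace X] [PolishSpace X] [MeasurableSpace X]
    [BorelSpace X] where
  dist : X → X → ℝ≥0∞
  isLawvereMetric_dist : IsLawvereMetric dist
  lowerSemicontinuous_dist : LowerSemicontinuous fun z : X × X => dist z.1 z.2
  measure : Measure X
  sigmaFinite_measure : SigmaFinite measure

/-- Markov kernels from `X` to `Y`. -/
abbrev MarkovKernel (X : Type u) (Y : Type v) [MeasurableSpace X] [MeasurableSpace Y] :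
    Type (max u v) :=
  {M : Kernel X Y // IsMarkovKernel M}

namespace MarkovKernel

variable {X : Type u} {Y : Type v} [MeasurableSpace X] [MeasurableSpace Y]

/-- The set of couplings of two Markov kernels `M, N : X → Y`: Markov kernels `X → Y × Y` whose
first marginal is `M` and whose second marginal is `N`. -/
def couplings (M N : MarkovKernel X Y) : Set (MarkovKernel X (Y × Y)) :=
  {P | P.1.map Prod.fst = M.1 ∧ P.1.map Prod.snd = N.1}

/-- The Wasserstein metric of order `p` between Markov kernels `X → Y`, for a measure `μ` on `X`
and a distance `d` on `Y`. -/
noncomputable def wasserstein (μ : Measure X) (d : Y → Y → ℝ≥0∞) (p : ℝ) (M N : MarkovKernel X Y) :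
    ℝ≥0∞ :=
  ⨅ P ∈ couplings M N, (∫⁻ x, ∫⁻ z, d z.1 z.2 ^ p ∂(P.1 x) ∂μ) ^ (1 / p)

/-- The Markov kernel `M` has a finite moment of order `p` with respect to the base point `y₀`. -/
def HasFiniteMoment (μ : Measure X) (d : Y → Y → ℝ≥0∞) (p : ℝ) (y₀ : Y) (M : MarkovKernel X Y) :
    Prop :=
  ∫⁻ x, ∫⁻ y, d y₀ y ^ p ∂(M.1 x) ∂μ < ∞

/-- Equality `μ`-almost everywhere, on the Markov kernels that satisfy the predicate `K`. -/
def aeSetoid (μ : Measure X) (K : MarkovKernel X Y → Prop) : Setoid {M : MarkovKernel X Y // K M} where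
  r M N := ∀ᵐ x ∂μ, M.1.1 x = N.1.1 x
  iseqv :=
    { refl := fun _ => Filter.Eventually.of_forall fun _ => rfl
      symm := fun h => h.mono fun _ hx => hx.symm
      trans := fun h₁ h₂ => h₁.mp (h₂.mono fun _ hx₂ hx₁ => hx₁.trans hx₂) }

/-- Equivalence classes, up to equality `μ`-almost everywhere, of the Markov kernels that satisfy
the predicate `K`. -/
abbrev AEClass (μ : Measure X) (K : MarkovKernel X Y → Prop) : Type (max u v) :=
  Quotient (aeSetoid μ K)

/-- The Wasserstein metric, restricted to the Markov kernels that satisfy the predicate `K`, is well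
defined on their classes up to equality `μ`-almost everywhere and is a classical metric there. -/
def IsClassicalOn (μ : Measure X) (d : Y → Y → ℝ≥0∞) (p : ℝ) (K : MarkovKernel X Y → Prop) : Prop :=
  ∃ D : AEClass μ K → AEClass μ K → ℝ≥0∞,
    (∀ M N : {M : MarkovKernel X Y // K M},
      D (Quotient.mk (aeSetoid μ K) M) (Quotient.mk (aeSetoid μ K) N)
        = wasserstein μ d p M.1 N.1) ∧
    IsClassicalMetric D

end MarkovKernel

namespace MarkovKernel

section General

variable {X : Type u} {Y : Type v} [MeasurableSpace X] [MeasurableSpace Y]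

/-- The integral of `d ^ p` along a kernel with values in `Y × Y`. -/
noncomputable def transportCost (μ : Measure X) (d : Y → Y → ℝ≥0∞) (p : ℝ)
    (P : Kernel X (Y × Y)) : ℝ≥0∞ :=
  ∫⁻ x, ∫⁻ z, d z.1 z.2 ^ p ∂(P x) ∂μ

/-- The product coupling of two Markov kernels. -/
noncomputable def prodCoupling (M N : MarkovKernel X Y) : MarkovKernel X (Y × Y) :=
  haveI := M.2
  haveI := N.2
  ⟨M.1 ×ₖ N.1, inferInstance⟩

theorem prodCoupling_mem (M N : MarkovKernel X Y) : prodCoupling M N ∈ couplings M N := by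
  have := M.2
  have := N.2
  constructor
  · exact (Kernel.fst_eq _).symm.trans (Kernel.fst_prod M.1 N.1)
  · exact (Kernel.snd_eq _).symm.trans (Kernel.snd_prod M.1 N.1)

/-- Pushforward of a Markov kernel along a measurable map. -/
noncomputable def push {Z : Type*} [MeasurableSpace Z] (M : MarkovKernel X Y) (f : Y → Z)
    (hf : Measurable f) : MarkovKernel X Z :=
  haveI := M.2
  ⟨M.1.map f, Kernel.IsMarkovKernel.map M.1 hf⟩

/-- A Markov kernel with values in `Z` and measurable maps `f, g : Z → Y` give a coupling of the two
pushforwards. -/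
theorem push_mem_couplings {Z : Type*} [MeasurableSpace Z] (M : MarkovKernel X Z)
    {f g : Z → Y} (hf : Measurable f) (hg : Measurable g) :
    push M (fun z => (f z, g z)) (hf.prodMk hg) ∈ couplings (push M f hf) (push M g hg) := by
  constructor
  · change (M.1.map _).map _ = M.1.map _
    rw [← Kernel.map_comp_right _ (hf.prodMk hg) measurable_fst]
    rfl
  · change (M.1.map _).map _ = M.1.map _
    rw [← Kernel.map_comp_right _ (hf.prodMk hg) measurable_snd]
    rfl

theorem wasserstein_le_of_mem {μ : Measure X} {d : Y → Y → ℝ≥0∞} {p : ℝ} {M N : MarkovKernel X Y}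
    {P : MarkovKernel X (Y × Y)} (hP : P ∈ couplings M N) :
    wasserstein μ d p M N ≤ transportCost μ d p P.1 ^ (1 / p) :=
  iInf₂_le P hP

theorem transportCost_map {Z : Type*} [MeasurableSpace Z] (μ : Measure X) {d : Y → Y → ℝ≥0∞}
    (hd : Measurable fun z : Y × Y => d z.1 z.2) (p : ℝ) (R : Kernel X Z)
    {f : Z → Y × Y} (hf : Measurable f) :
    transportCost μ d p (R.map f) = ∫⁻ x, ∫⁻ z, d (f z).1 (f z).2 ^ p ∂(R x) ∂μ := by
  refine lintegral_congr fun x => ?_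
  rw [Kernel.lintegral_map _ hf _ (hd.pow_const p)]

theorem wasserstein_comm (μ : Measure X) {d : Y → Y → ℝ≥0∞}
    (hd : Measurable fun z : Y × Y => d z.1 z.2) (hsymm : ∀ x y, d x y = d y x) (p : ℝ)
    (M N : MarkovKernel X Y) : wasserstein μ d p M N = wasserstein μ d p N M := by
  suffices h : ∀ M N : MarkovKernel X Y, wasserstein μ d p M N ≤ wasserstein μ d p N M from
    le_antisymm (h M N) (h N M)
  intro M N
  refine le_iInf₂ fun P hP => ?_
  have hmem : push P Prod.swap measurable_swap ∈ couplings M N := by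
    have h := push_mem_couplings P measurable_snd measurable_fst
    rwa [show push P Prod.snd measurable_snd = M from Subtype.ext hP.2,
      show push P Prod.fst measurable_fst = N from Subtype.ext hP.1] at h
  refine (wasserstein_le_of_mem hmem).trans_eq ?_
  rw [push, transportCost_map μ hd p _ measurable_swap]
  simp only [Prod.fst_swap, Prod.snd_swap, hsymm]

/-- Markov kernels that agree almost everywhere are at Wasserstein distance zero. -/
theorem wasserstein_eq_zero_of_ae_eq {μ : Measure X} {d : Y → Y → ℝ≥0∞}
    (hd : Measurable fun z : Y × Y => d z.1 z.2) (hself : ∀ y, d y y = 0) {p : ℝ} (hp : 0 < p)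
    {M N : MarkovKernel X Y} (h : ∀ᵐ x ∂μ, M.1 x = N.1 x) : wasserstein μ d p M N = 0 := by
  classical
  have := M.2
  let t := toMeasurable μ {x | ¬ M.1 x = N.1 x}
  have ht : MeasurableSet t := measurableSet_toMeasurable _ _
  have hμt : μ t = 0 := by rw [measure_toMeasurable]; exact h
  have heq : ∀ x ∉ t, M.1 x = N.1 x := fun x hx =>
    not_not.1 fun hne => hx (subset_toMeasurable _ _ hne)
  have hdiag : Measurable fun y : Y => (y, y) := measurable_id.prodMk measurable_id
  let D := push M (fun y : Y => (y, y)) hdiag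
  have := D.2
  have := (prodCoupling M N).2
  let P : MarkovKernel X (Y × Y) := ⟨Kernel.piecewise ht (prodCoupling M N).1 D.1, inferInstance⟩
  have hfst : D.1.map Prod.fst = M.1 := by
    refine ((push_mem_couplings M measurable_id measurable_id).1).trans ?_
    exact Kernel.map_id _
  have hsnd : D.1.map Prod.snd = M.1 := by
    refine ((push_mem_couplings M measurable_id measurable_id).2).trans ?_
    exact Kernel.map_id _
  have hP : P ∈ couplings M N := by
    constructor
    · ext1 x
      rw [Kernel.map_apply _ measurable_fst]
      by_cases hx : x ∈ t
      · rw [← (prodCoupling_mem M N).1, Kernel.map_apply _ measurable_fst]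
        simp [P, Kernel.piecewise_apply, hx]
      · rw [← hfst, Kernel.map_apply _ measurable_fst]
        simp [P, Kernel.piecewise_apply, hx]
    · ext1 x
      rw [Kernel.map_apply _ measurable_snd]
      by_cases hx : x ∈ t
      · rw [← (prodCoupling_mem M N).2, Kernel.map_apply _ measurable_snd]
        simp [P, Kernel.piecewise_apply, hx]
      · rw [← heq x hx, ← hsnd, Kernel.map_apply _ measurable_snd]
        simp [P, Kernel.piecewise_apply, hx]
  have hcost : transportCost μ d p P.1 = 0 := by
    have hae : ∀ᵐ x ∂μ, x ∉ t := by rw [ae_iff]; simpa using hμt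
    refine (lintegral_congr_ae (g := fun _ => 0) ?_).trans lintegral_zero
    filter_upwards [hae] with x hx
    have hPx : P.1 x = D.1 x := by simp [P, Kernel.piecewise_apply, hx]
    rw [hPx]
    change ∫⁻ z : Y × Y, d z.1 z.2 ^ p ∂((M.1.map _) x) = 0
    rw [Kernel.lintegral_map _ hdiag _ (hd.pow_const p)]
    simp [hself, hp]
  refine le_antisymm ((wasserstein_le_of_mem hP).trans_eq ?_) bot_le
  rw [hcost, ENNReal.zero_rpow_of_pos (by positivity)]

/-- Minkowski's inequality for a kernel and a function dominated by a sum of two others. -/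
theorem lintegral_kernel_rpow_triangle {Z : Type*} [MeasurableSpace Z] (μ : Measure X) [SFinite μ]
    (R : Kernel X Z) [IsSFiniteKernel R] {p : ℝ} (hp : 1 ≤ p) {f g h : Z → ℝ≥0∞}
    (hf : Measurable f) (hg : Measurable g) (hh : Measurable h) (hle : ∀ z, h z ≤ f z + g z) :
    (∫⁻ x, ∫⁻ z, h z ^ p ∂(R x) ∂μ) ^ (1 / p) ≤
      (∫⁻ x, ∫⁻ z, f z ^ p ∂(R x) ∂μ) ^ (1 / p) + (∫⁻ x, ∫⁻ z, g z ^ p ∂(R x) ∂μ) ^ (1 / p) := by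
  have key : ∀ k : Z → ℝ≥0∞, Measurable k →
      ∫⁻ x, ∫⁻ z, k z ^ p ∂(R x) ∂μ = ∫⁻ w, k w.2 ^ p ∂(μ ⊗ₘ R) := fun k hk =>
    (Measure.lintegral_compProd (f := fun w : X × Z => k w.2 ^ p)
      ((hk.comp measurable_snd).pow_const p)).symm
  rw [key f hf, key g hg, key h hh]
  have hp0 : 0 ≤ p := zero_le_one.trans hp
  refine le_trans ?_ (ENNReal.lintegral_Lp_add_le (μ := μ ⊗ₘ R)
    (hf.comp measurable_snd).aemeasurable (hg.comp measurable_snd).aemeasurable hp)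
  refine ENNReal.rpow_le_rpow (lintegral_mono fun w => ?_) (by positivity)
  exact ENNReal.rpow_le_rpow (hle w.2) hp0

/-- The constant kernel at a Dirac mass. -/
noncomputable def dirac (X : Type u) [MeasurableSpace X] (y₀ : Y) : MarkovKernel X Y :=
  ⟨Kernel.const X (Measure.dirac y₀), inferInstance⟩

theorem wasserstein_dirac_lt_top {μ : Measure X} {d : Y → Y → ℝ≥0∞}
    (hd : Measurable fun z : Y × Y => d z.1 z.2) {p : ℝ} (hp : 0 < p) {y₀ : Y}
    {M : MarkovKernel X Y} (hM : HasFiniteMoment μ d p y₀ M) :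
    wasserstein μ d p (dirac X y₀) M < ∞ := by
  have := M.2
  have hc : Measurable fun _ : Y => y₀ := measurable_const
  have hmem := push_mem_couplings M hc measurable_id
  have h1 : push M (fun _ : Y => y₀) hc = dirac X y₀ := by
    refine Subtype.ext (Kernel.ext fun x => ?_)
    change M.1.map _ x = Kernel.const X (Measure.dirac y₀) x
    rw [Kernel.map_apply _ hc, Measure.map_const]
    simp
  have h2 : push M id measurable_id = M := Subtype.ext (Kernel.map_id _)
  rw [h1, h2] at hmem
  refine (wasserstein_le_of_mem hmem).trans_lt ?_
  rw [push, transportCost_map μ hd p _ (hc.prodMk measurable_id)]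
  exact ENNReal.rpow_lt_top_of_nonneg (by positivity) hM.ne

theorem HasFiniteMoment.change_base {μ : Measure X} [IsFiniteMeasure μ] {d : Y → Y → ℝ≥0∞}
    (hd : Measurable fun z : Y × Y => d z.1 z.2) (hclass : IsClassicalMetric d) {p : ℝ}
    (hp : 1 ≤ p) {M : MarkovKernel X Y} {y₀ : Y} (y₁ : Y) (hM : HasFiniteMoment μ d p y₀ M) :
    HasFiniteMoment μ d p y₁ M := by
  have := M.2
  have hp0 : 0 < p := zero_lt_one.trans_le hp
  have hm : ∀ y : Y, Measurable (d y) := fun y =>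
    hd.comp (measurable_const.prodMk measurable_id)
  have h := lintegral_kernel_rpow_triangle μ M.1 hp (measurable_const (a := d y₁ y₀)) (hm y₀)
    (hm y₁) (fun y => hclass.triangle y₁ y₀ y)
  have hfin : (∫⁻ x, ∫⁻ y, d y₁ y ^ p ∂(M.1 x) ∂μ) ^ (1 / p) < ∞ := by
    refine h.trans_lt (ENNReal.add_lt_top.2 ⟨?_, ?_⟩)
    · refine ENNReal.rpow_lt_top_of_nonneg (by positivity) ?_
      simp only [lintegral_const, measure_univ, mul_one]
      exact ENNReal.mul_ne_top
        (ENNReal.rpow_ne_top_of_nonneg hp0.le (hclass.finite _ _).ne) (measure_ne_top _ _)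
    · exact ENNReal.rpow_lt_top_of_nonneg (by positivity) hM.ne
  exact (ENNReal.rpow_lt_top_iff_of_pos (by positivity)).1 hfin

end General

section Gluing

variable {X : Type u} {Y : Type v} [MeasurableSpace X] [MeasurableSpace Y]

/-- Gluing of couplings along a common marginal. -/
theorem exists_gluing [StandardBorelSpace X] [StandardBorelSpace Y] [Nonempty Y]
    {M₁ M₂ M₃ : MarkovKernel X Y} {P Q : MarkovKernel X (Y × Y)} (hP : P ∈ couplings M₁ M₂)
    (hQ : Q ∈ couplings M₂ M₃) :
    ∃ R : MarkovKernel X ((Y × Y) × Y),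
      R.1.map Prod.fst = P.1 ∧ R.1.map (fun w => (w.1.2, w.2)) = Q.1 := by
  have := P.2
  have := Q.2
  let K : Kernel (X × Y) Y := Q.1.condKernel
  have hg : Measurable fun w : X × (Y × Y) => (w.1, w.2.2) := by fun_prop
  let K' : Kernel (X × (Y × Y)) Y := K.comap _ hg
  refine ⟨⟨P.1 ⊗ₖ K', inferInstance⟩, ?_, ?_⟩
  · change (P.1 ⊗ₖ K').map Prod.fst = _
    rw [← Kernel.fst_eq, Kernel.fst_compProd]
  · have hw : Measurable fun w : (Y × Y) × Y => (w.1.2, w.2) := by fun_prop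
    change (P.1 ⊗ₖ K').map _ = _
    have hdis : Q.1.fst ⊗ₖ K = Q.1 := Q.1.disintegrate Q.1.condKernel
    have hQf : Q.1.fst = P.1.map Prod.snd := by
      rw [Kernel.fst_eq, hQ.1, hP.2]
    conv_rhs => rw [← hdis, hQf]
    have : IsMarkovKernel (P.1.map Prod.snd) := Kernel.IsMarkovKernel.map _ measurable_snd
    refine Kernel.ext fun x => Measure.ext fun s hs => ?_
    rw [Kernel.map_apply' _ hw _ hs, Kernel.compProd_apply (hw hs), Kernel.compProd_apply hs,
      Kernel.lintegral_map _ measurable_snd]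
    · rfl
    · exact Kernel.measurable_kernel_prodMk_left' hs x

theorem wasserstein_triangle [StandardBorelSpace X] [StandardBorelSpace Y] (μ : Measure X)
    [SFinite μ] {d : Y → Y → ℝ≥0∞} (hd : Measurable fun z : Y × Y => d z.1 z.2)
    (htri : ∀ x y z, d x z ≤ d x y + d y z) {p : ℝ} (hp : 1 ≤ p) (M₁ M₂ M₃ : MarkovKernel X Y) :
    wasserstein μ d p M₁ M₃ ≤ wasserstein μ d p M₁ M₂ + wasserstein μ d p M₂ M₃ := by
  have hp0 : 0 < p := zero_lt_one.trans_le hp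
  have key : ∀ P ∈ couplings M₁ M₂, ∀ Q ∈ couplings M₂ M₃, wasserstein μ d p M₁ M₃ ≤
      transportCost μ d p P.1 ^ (1 / p) + transportCost μ d p Q.1 ^ (1 / p) := by
    intro P hP Q hQ
    rcases isEmpty_or_nonempty Y with hY | hY
    · refine (wasserstein_le_of_mem (prodCoupling_mem M₁ M₃)).trans ?_
      have h0 : transportCost μ d p (prodCoupling M₁ M₃).1 = 0 := by
        simp [transportCost, Measure.eq_zero_of_isEmpty]
      rw [h0, ENNReal.zero_rpow_of_pos (by positivity)]
      exact bot_le
    obtain ⟨R, hR₁, hR₂⟩ := exists_gluing hP hQ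
    have := R.2
    have m1 : Measurable fun w : (Y × Y) × Y => w.1.1 := by fun_prop
    have m2 : Measurable fun w : (Y × Y) × Y => w.1.2 := by fun_prop
    have m3 : Measurable fun w : (Y × Y) × Y => w.2 := by fun_prop
    have hmem : push R (fun w => (w.1.1, w.2)) (m1.prodMk m3) ∈ couplings M₁ M₃ := by
      have h := push_mem_couplings R m1 m3
      have e1 : push R _ m1 = M₁ := by
        refine Subtype.ext ?_
        rw [← hP.1, ← hR₁, ← Kernel.map_comp_right _ measurable_fst measurable_fst]
        rfl
      have e3 : push R _ m3 = M₃ := by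
        refine Subtype.ext ?_
        rw [← hQ.2, ← hR₂, ← Kernel.map_comp_right _ (m2.prodMk m3) measurable_snd]
        rfl
      rwa [e1, e3] at h
    refine (wasserstein_le_of_mem hmem).trans ?_
    rw [push, ← hR₁, ← hR₂, transportCost_map μ hd p _ (m1.prodMk m3),
      transportCost_map μ hd p _ measurable_fst, transportCost_map μ hd p _ (m2.prodMk m3)]
    exact lintegral_kernel_rpow_triangle μ R.1 hp (hd.comp (m1.prodMk m2))
      (hd.comp (m2.prodMk m3)) (hd.comp (m1.prodMk m3)) (fun w => htri _ _ _)
  rw [show wasserstein μ d p M₁ M₂ = _ from iInf_subtype',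
    show wasserstein μ d p M₂ M₃ = _ from iInf_subtype', ENNReal.iInf_add]
  refine le_iInf fun P => ?_
  rw [ENNReal.add_iInf]
  refine le_iInf fun Q => ?_
  exact key P.1 P.2 Q.1 Q.2

end Gluing

section Separation

variable {Y : Type v} [TopologicalSpace Y] [PolishSpace Y] [MeasurableSpace Y] [BorelSpace Y]

/-- If a lower semicontinuous function is positive off the diagonal and has arbitrarily small
integrals along couplings of two probability measures, the first measure is dominated by the
second. -/
theorem measure_le_of_small_couplings {c : Y × Y → ℝ≥0∞} (hc : LowerSemicontinuous c)
    (hpos : ∀ x y, c (x, y) = 0 → x = y) {m n : Measure Y} [IsProbabilityMeasure m]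
    [IsProbabilityMeasure n]
    (h : ∀ ε : ℝ≥0∞, 0 < ε → ∃ π : Measure (Y × Y),
      π.map Prod.fst = m ∧ π.map Prod.snd = n ∧ ∫⁻ z, c z ∂π < ε) : m ≤ n := by
  rw [Measure.le_iff]
  intro s hs
  by_contra! hlt
  obtain ⟨K, hKs, hK, hnK⟩ := hs.exists_lt_isCompact hlt
  have hmK1 : m K ≤ 1 := prob_le_one
  have hlt' : 1 - m K < n sᶜ := by
    refine ENNReal.sub_lt_of_lt_add hmK1 ?_
    rw [← prob_add_prob_compl (μ := n) hs, add_comm (n sᶜ)]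
    exact ENNReal.add_lt_add_right (measure_ne_top _ _) hnK
  obtain ⟨L, hLs, hL, hnL⟩ := hs.compl.exists_lt_isCompact hlt'
  have hLc : n Lᶜ < m K := by
    rw [prob_compl_eq_one_sub hL.measurableSet]
    refine ENNReal.sub_lt_of_lt_add prob_le_one ?_
    rw [add_comm]
    exact (ENNReal.sub_lt_iff_lt_right (measure_ne_top _ _) hmK1).1 hnL
  have hKne : K.Nonempty := nonempty_of_measure_ne_zero (bot_le.trans_lt hnK).ne'
  have hLne : L.Nonempty := nonempty_of_measure_ne_zero (bot_le.trans_lt hnL).ne'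
  obtain ⟨z, hz, hmin⟩ := LowerSemicontinuousOn.exists_isMinOn (hKne.prod hLne) (hK.prod hL)
    (hc.lowerSemicontinuousOn _)
  have hcz : c z ≠ 0 := fun h0 =>
    hLs hz.2 (hpos z.1 z.2 h0 ▸ hKs hz.1)
  have hδ : 0 < m K - n Lᶜ := tsub_pos_of_lt hLc
  obtain ⟨π, h1, h2, h3⟩ := h (c z * (m K - n Lᶜ)) (ENNReal.mul_pos hcz hδ.ne')
  refine absurd h3 (not_lt.2 ?_)
  have hKL : MeasurableSet (K ×ˢ L) := hK.measurableSet.prod hL.measurableSet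
  have hmass : m K - n Lᶜ ≤ π (K ×ˢ L) := by
    rw [tsub_le_iff_right, ← h1, ← h2, Measure.map_apply measurable_fst hK.measurableSet,
      Measure.map_apply measurable_snd hL.measurableSet.compl]
    refine (measure_mono fun w hw => ?_).trans (measure_union_le _ _)
    by_cases hwL : w.2 ∈ L
    · exact Or.inl ⟨hw, hwL⟩
    · exact Or.inr hwL
  calc c z * (m K - n Lᶜ) ≤ c z * π (K ×ˢ L) := by gcongr
    _ = ∫⁻ _ in K ×ˢ L, c z ∂π := by simp
    _ ≤ ∫⁻ w in K ×ˢ L, c w ∂π := setLIntegral_mono' hKL fun w hw => hmin hw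
    _ ≤ ∫⁻ w, c w ∂π := setLIntegral_le_lintegral _ _

theorem measure_eq_of_small_couplings {c : Y × Y → ℝ≥0∞} (hc : LowerSemicontinuous c)
    (hpos : ∀ x y, c (x, y) = 0 → x = y) {m n : Measure Y} [IsProbabilityMeasure m]
    [IsProbabilityMeasure n]
    (h : ∀ ε : ℝ≥0∞, 0 < ε → ∃ π : Measure (Y × Y),
      π.map Prod.fst = m ∧ π.map Prod.snd = n ∧ ∫⁻ z, c z ∂π < ε) : m = n :=
  Measure.eq_of_le_of_measure_univ_eq (measure_le_of_small_couplings hc hpos h) (by simp)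

theorem ae_eq_of_wasserstein_eq_zero {X : Type u} [MeasurableSpace X] {μ : Measure X}
    {d : Y → Y → ℝ≥0∞} (hd : LowerSemicontinuous fun z : Y × Y => d z.1 z.2)
    (hpos : ∀ x y, d x y = 0 → x = y) {p : ℝ} (hp : 0 < p) {M N : MarkovKernel X Y}
    (h : wasserstein μ d p M N = 0) : ∀ᵐ x ∂μ, M.1 x = N.1 x := by
  have hc : LowerSemicontinuous fun z : Y × Y => d z.1 z.2 ^ p :=
    (ENNReal.continuous_rpow_const (y := p)).comp_lowerSemicontinuous hd
      (ENNReal.monotone_rpow_of_nonneg hp.le)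
  have hex : ∀ k : ℕ, ∃ P ∈ couplings M N, transportCost μ d p P.1 < (k : ℝ≥0∞)⁻¹ := by
    intro k
    have hlt : wasserstein μ d p M N < ((k : ℝ≥0∞)⁻¹) ^ (1 / p) := by
      rw [h]
      exact ENNReal.rpow_pos_of_nonneg (by simp) (by positivity)
    simp only [wasserstein, iInf_lt_iff] at hlt
    obtain ⟨P, hP, hlt⟩ := hlt
    exact ⟨P, hP, (ENNReal.rpow_lt_rpow_iff (by positivity)).1 hlt⟩
  choose P hP hcost using hex
  let f : ℕ → X → ℝ≥0∞ := fun k x => ∫⁻ z, d z.1 z.2 ^ p ∂((P k).1 x)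
  have hf : ∀ k, Measurable (f k) := fun k => hc.measurable.lintegral_kernel
  have hzero : ∫⁻ x, ⨅ k, f k x ∂μ = 0 := by
    refine le_antisymm (ge_of_tendsto' ENNReal.tendsto_inv_nat_nhds_zero fun k => ?_) bot_le
    exact (lintegral_mono fun x => iInf_le _ k).trans (hcost k).le
  rw [lintegral_eq_zero_iff (Measurable.iInf hf)] at hzero
  filter_upwards [hzero] with x hx
  have := M.2
  have := N.2
  refine measure_eq_of_small_couplings hc (fun a b hab => hpos a b ?_) fun ε hε => ?_
  · exact (ENNReal.rpow_eq_zero_iff_of_pos hp).1 hab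
  · have hlt : ⨅ k, f k x < ε := by rw [show ⨅ k, f k x = 0 from hx]; exact hε
    obtain ⟨k, hk⟩ := iInf_lt_iff.1 hlt
    refine ⟨(P k).1 x, ?_, ?_, hk⟩
    · rw [← (hP k).1, Kernel.map_apply _ measurable_fst]
    · rw [← (hP k).2, Kernel.map_apply _ measurable_snd]

end Separation

/-- On a class of Markov kernels at finite mutual distance, the Wasserstein metric descends to a classical
metric on equivalence classes, once it is a symmetric metric that vanishes precisely on equivalent kernels. -/
theorem isClassicalOn_of_lt_top {X : Type u} {Y : Type v} [MeasurableSpace X] [MeasurableSpace Y]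
    {μ : Measure X} {d : Y → Y → ℝ≥0∞} {p : ℝ} {K : MarkovKernel X Y → Prop}
    (hL : IsLawvereMetric (wasserstein (X := X) μ d p))
    (hsymm : ∀ M N : MarkovKernel X Y, wasserstein μ d p M N = wasserstein μ d p N M)
    (hzero : ∀ M N : MarkovKernel X Y,
      wasserstein μ d p M N = 0 ↔ ∀ᵐ x ∂μ, M.1 x = N.1 x)
    (hfin : ∀ M N : MarkovKernel X Y, K M → K N → wasserstein μ d p M N < ∞) :
    IsClassicalOn μ d p K := by
  have hle : ∀ M N M' N' : MarkovKernel X Y, (∀ᵐ x ∂μ, M.1 x = M'.1 x) →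
      (∀ᵐ x ∂μ, N.1 x = N'.1 x) → wasserstein μ d p M N ≤ wasserstein μ d p M' N' := by
    intro M N M' N' hM hN
    have h1 := hL.triangle M M' N
    have h2 := hL.triangle M' N' N
    rw [(hzero M M').2 hM, zero_add] at h1
    rw [hsymm N' N, (hzero N N').2 hN, add_zero] at h2
    exact h1.trans h2
  refine ⟨Quotient.lift₂ (fun M N => wasserstein μ d p M.1 N.1) ?_, fun M N => rfl, ?_⟩
  · intro M N M' N' hM hN
    exact le_antisymm (hle _ _ _ _ hM hN)
      (hle _ _ _ _ ((aeSetoid μ K).symm hM) ((aeSetoid μ K).symm hN))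
  · refine { self := ?_, triangle := ?_, finite := ?_, posDef := ?_, symm := ?_ }
    · rintro ⟨M⟩
      exact hL.self M.1
    · rintro ⟨M⟩ ⟨N⟩ ⟨O⟩
      exact hL.triangle M.1 N.1 O.1
    · rintro ⟨M⟩ ⟨N⟩
      exact hfin M.1 N.1 M.2 N.2
    · rintro ⟨M⟩ ⟨N⟩ h
      exact Quotient.sound ((hzero M.1 N.1).1 h)
    · rintro ⟨M⟩ ⟨N⟩
      exact hsymm M.1 N.1

end MarkovKernel

theorem mainTheorem2 {X : Type u} [TopologicalSpace X] [PolishSpace X] [MeasurableSpace X]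
    [BorelSpace X] {Y : Type v} [TopologicalSpace Y] [PolishSpace Y] [MeasurableSpace Y]
    [BorelSpace Y] (mmX : MMStructure X) (mmY : MMStructure Y) (p : ℝ) (hp : 1 ≤ p) :
    IsLawvereMetric (MarkovKernel.wasserstein (X := X) mmX.measure mmY.dist p) ∧
    (IsClassicalMetric mmY.dist →
      (∀ M N : MarkovKernel X Y,
        MarkovKernel.wasserstein mmX.measure mmY.dist p M N
          = MarkovKernel.wasserstein mmX.measure mmY.dist p N M) ∧
      (∀ M N : MarkovKernel X Y,
        MarkovKernel.wasserstein mmX.measure mmY.dist p M N = 0 ↔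
          ∀ᵐ x ∂mmX.measure, M.1 x = N.1 x) ∧
      (∀ y₀ : Y, MarkovKernel.IsClassicalOn (X := X) mmX.measure mmY.dist p
        (MarkovKernel.HasFiniteMoment mmX.measure mmY.dist p y₀)) ∧
      (IsFiniteMeasure mmX.measure →
        (∀ (M : MarkovKernel X Y) (y₀ y₁ : Y),
          MarkovKernel.HasFiniteMoment mmX.measure mmY.dist p y₀ M →
          MarkovKernel.HasFiniteMoment mmX.measure mmY.dist p y₁ M) ∧
        MarkovKernel.IsClassicalOn (X := X) mmX.measure mmY.dist p
          (fun M => ∃ y₀ : Y, MarkovKernel.HasFiniteMoment mmX.measure mmY.dist p y₀ M))) := by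
  have hp0 : 0 < p := zero_lt_one.trans_le hp
  have hlsc := mmY.lowerSemicontinuous_dist
  have hd : Measurable fun z : Y × Y => mmY.dist z.1 z.2 := hlsc.measurable
  have := mmX.sigmaFinite_measure
  have hdY := mmY.isLawvereMetric_dist
  have hL : IsLawvereMetric (MarkovKernel.wasserstein (X := X) mmX.measure mmY.dist p) :=
    { self := fun M => MarkovKernel.wasserstein_eq_zero_of_ae_eq hd hdY.self hp0
        (Filter.Eventually.of_forall fun _ => rfl)
      triangle := MarkovKernel.wasserstein_triangle _ hd hdY.triangle hp }
  refine ⟨hL, fun hclass => ?_⟩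
  have hsymm := MarkovKernel.wasserstein_comm (X := X) mmX.measure hd hclass.symm p
  have hzero : ∀ M N : MarkovKernel X Y,
      MarkovKernel.wasserstein mmX.measure mmY.dist p M N = 0 ↔
        ∀ᵐ x ∂mmX.measure, M.1 x = N.1 x := fun M N =>
    ⟨MarkovKernel.ae_eq_of_wasserstein_eq_zero hlsc hclass.posDef hp0,
      MarkovKernel.wasserstein_eq_zero_of_ae_eq hd hdY.self hp0⟩
  have hfin : ∀ (y₀ : Y) (M N : MarkovKernel X Y),
      MarkovKernel.HasFiniteMoment mmX.measure mmY.dist p y₀ M →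
      MarkovKernel.HasFiniteMoment mmX.measure mmY.dist p y₀ N →
      MarkovKernel.wasserstein mmX.measure mmY.dist p M N < ∞ := by
    intro y₀ M N hM hN
    refine (hL.triangle M (MarkovKernel.dirac X y₀) N).trans_lt (ENNReal.add_lt_top.2 ⟨?_, ?_⟩)
    · rw [hsymm]
      exact MarkovKernel.wasserstein_dirac_lt_top hd hp0 hM
    · exact MarkovKernel.wasserstein_dirac_lt_top hd hp0 hN
  refine ⟨hsymm, hzero, fun y₀ => ?_, fun hμ => ?_⟩
  · exact MarkovKernel.isClassicalOn_of_lt_top hL hsymm hzero (hfin y₀)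
  · have hbase : ∀ (M : MarkovKernel X Y) (y₀ y₁ : Y),
        MarkovKernel.HasFiniteMoment mmX.measure mmY.dist p y₀ M →
        MarkovKernel.HasFiniteMoment mmX.measure mmY.dist p y₁ M :=
      fun _ _ y₁ h => h.change_base hd hclass hp y₁
    refine ⟨hbase, MarkovKernel.isClassicalOn_of_lt_top hL hsymm hzero ?_⟩
    rintro M N ⟨y₀, hM⟩ ⟨y₁, hN⟩
    exact hfin y₀ M N hM (hbase N y₁ y₀ hN)
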